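/- Let $G$ be a countably infinite amenable group, where amenable means that $G$ has a Følner sequence, i.e. a sequence of nonempty finite sets $F_n\subset G$ with $|KF_n\,\triangle\,F_n|/|F_n|\to 0$ for every nonempty finite $K\subset G$. A $G$-topological dynamical system $(X,T)$ is a nonempty compact metric space $X$ with a left action $T$ of $G$ on $X$ by homeomorphisms $T^g$, $g\in G$. For an open cover $\mathcal U$ of $X$ let $N(\mathcal U)$ be the minimal cardinality of a subcover and let $\mathcal U^{F}=\bigvee_{g\in F}T^{g^{-1}}\mathcal U$ for finite $F\subset G$; put $$h_{\mathrm{top}}(T,\mathcal U)=\lim_{n\to\infty}\frac1{|F_n|}\log N(\mathcal U^{F_n}),$$ where $(F_n)$ is a Følner sequence (the limit exists and does not depend on the choice of the sequence). A pair $(x,y)\in X^2$ is an entropy pair if $x\ne y$ and $h_{\mathrm{top}}(T,\{A^{c},B^{c}\})>0$ for all disjoint closed neighbourhoods $A$ of $x$ and $B$ of $y$. Let $E(X,T)$ be the set of entropy pairs, $\Delta$ the diagonal of $X^2$, and $R^+$ the smallest equivalence relation on $X$ containing $R\subset X^2$. Define, by transfinite induction over the ordinals $\alpha\ge1$: $E_1(X,T)=E(X,T)\cup\Delta$;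 if $\alpha=\beta+1$ with $\beta\ge1$, then $E_\alpha(X,T)=\overline{E_{\beta}(X,T)}$ if $E_{\beta}(X,T)$ is not closed in $X^2$, and $E_\alpha(X,T)=E_{\beta}(X,T)^+$ otherwise; if $\alpha$ is a limit ordinal, then $E_\alpha(X,T)=\bigcup_{1\le\beta<\alpha}E_\beta(X,T)$. The system $(X,T)$ is in the CPE class $\alpha$ if $E_\alpha(X,T)=X^2$ and $E_\beta(X,T)\ne X^2$ for every $1\le\beta<\alpha$. **Theorem.** For every countable ordinal $\alpha\ge 1$ there is a $G$-topological dynamical system in the CPE class $\alpha$. -/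

import Mathlib

universe u v

open Filter Set Topology
open scoped Pointwise symmDiff Cardinal

namespace CPE

/-! ### Amenability -/

section Amenable

variable {G : Type*} [Group G]

/-- A (left) Følner sequence in a discrete group: finite nonempty sets `F n` such that
`|K · F n ∆ F n| / |F n| → 0` for every finite nonempty `K ⊆ G`. -/
structure IsFolnerSeq (F : ℕ → Finset G) : Prop where
  nonempty : ∀ n, (F n).Nonempty
  tendsto : ∀ K : Finset G, K.Nonempty →
    Tendsto (fun n => ((((K : Set G) * (F n : Set G)) ∆ (F n : Set G)).ncard : ℝ) / (F n).card)
      atTop (𝓝 0)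

variable (G) in
/-- A countable group is amenable if it admits a Følner sequence. -/
def IsAmenable : Prop := ∃ F : ℕ → Finset G, IsFolnerSeq F

end Amenable

/-! ### Open covers and topological entropy -/

section Entropy

variable {G X : Type*} [Group G] [MulAction G X]

/-- The refinement `⋁_{g ∈ F} T^{g⁻¹} 𝒰` of the cover `𝒰`: its members are the intersections
`⋂_{g ∈ F} T^{g⁻¹}(U_g)` with `U_g ∈ 𝒰`, where `T^{g⁻¹}(U)` is written as the preimage of `U`
under `T^g`. -/
def refineCover (U : Set (Set X)) (F : Finset G) : Set (Set X) :=
  {V | ∃ φ : G → Set X, (∀ g ∈ F, φ g ∈ U) ∧ V = ⋂ g ∈ F, (fun x : X => g • x) ⁻¹' (φ g)}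

/-- `N(𝒰)`: the minimum cardinality of a subcover of `𝒰` (there is a finite one whenever `𝒰` is an
open cover of a compact space). -/
noncomputable def minSubcover (U : Set (Set X)) : ℕ :=
  sInf {n | ∃ S : Finset (Set X), (S : Set (Set X)) ⊆ U ∧ ⋃₀ (S : Set (Set X)) = univ ∧ S.card = n}

/-- The topological entropy `h_top(T, 𝒰) = lim_n (1 / |F_n|) log N(𝒰^{F_n})` of the action with
respect to the cover `𝒰`, computed along `F`. For an open cover and a Følner sequence `F` the limit
exists (Ornstein–Weiss), hence it is the `limsup` written here. -/
noncomputable def coverEntropy (F : ℕ → Finset G) (U : Set (Set X)) : EReal :=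
  limsup (fun n => (((1 / ((F n).card : ℝ)) *
    Real.log (minSubcover (refineCover U (F n))) : ℝ) : EReal)) atTop

variable [TopologicalSpace X]

variable (X) in
/-- The set `E(X, T)` of entropy pairs: pairs of distinct points `(x, y)` such that
`h_top(T, {Aᶜ, Bᶜ}) > 0` for all disjoint closed neighbourhoods `A` of `x` and `B` of `y`. -/
def entropyPairs (F : ℕ → Finset G) : Set (X × X) :=
  {p | p.1 ≠ p.2 ∧ ∀ A B : Set X, IsClosed A → IsClosed B → A ∈ 𝓝 p.1 → B ∈ 𝓝 p.2 →
    Disjoint A B → 0 < coverEntropy F ({Aᶜ, Bᶜ} : Set (Set X))}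

end Entropy

/-! ### The hierarchy -/

section Hierarchy

/-- `R⁺`: the smallest equivalence relation on `X` that contains `R`. -/
def equivClosure {X : Type*} (R : Set (X × X)) : Set (X × X) :=
  {p | Relation.EqvGen (fun x y => (x, y) ∈ R) p.1 p.2}

variable {G : Type*} (X : Type*) [Group G] [MulAction G X] [TopologicalSpace X]

open Classical in
/-- The sets `E_α(X, T)`, for ordinals `α ≥ 1`:
* `E_1 = E(X, T) ∪ Δ`;
* `E_{β+1}` (`β ≥ 1`) is the closure of `E_β` if `E_β` is not closed, and `E_β⁺` otherwise;
* `E_α = ⋃_{β < α} E_β` if `α` is a limit ordinal.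
The value at `0` is a dummy, `∅`, which does not affect the others. -/
noncomputable def entropyHierarchy (F : ℕ → Finset G) (α : Ordinal) : Set (X × X) :=
  Ordinal.limitRecOn α ∅
    (fun β R =>
      if β = 0 then entropyPairs X F ∪ diagonal X
      else if IsClosed R then equivClosure R
      else closure R)
    (fun α _ R => ⋃ (β : Ordinal) (h : β < α), R β h)

/-- The system is in the CPE class `α` (`α ≥ 1`): `E_α = X²`, and `E_β ≠ X²` for every `β < α`
(the hierarchy starts at `1`). Entropy is computed along `F`. -/
def InCPEClass (F : ℕ → Finset G) (α : Ordinal) : Prop :=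
  entropyHierarchy X F α = univ ∧
    ∀ β : Ordinal, 1 ≤ β → β < α → entropyHierarchy X F β ≠ univ

end Hierarchy

end CPE

/-!
The systems are clique shifts: for a closed reflexive symmetric relation `R` on a compact
metrizable alphabet `Y`, the set `X ⊆ Y ^ G` of the configurations whose values are pairwise
`R`-related.

If the values of two configurations `u ≠ v`, taken together, are pairwise `R`-related, then
on a positive proportion of each finite subset of `G` the patterns of `u` and of `v` can be chosen
independently, which gives positive entropy. If some value `u g` is not related to some value `v h`,
then the same is true nearby, and no orbit can visit both neighbourhoods, so that the refined covers
have a subcover of two elements; the entropy is zero because Følner sets in an infinite group grow.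
So the first stage of the hierarchy is the closed set of the pairs with jointly related values
(`CliqueShift.entropyHierarchy_one`). Since a configuration `u` is related to the constant one at
`u 1`, from then on the hierarchy is the pullback of its counterpart on the alphabet under
`u ↦ u 1`: alternately close up `R` to an equivalence relation and take the topological closure
(`CliqueShift.entropyHierarchy_two_mul`).

The alphabet is built from intervals `[0, θ]` of countable ordinals, with two ordinals related if
each is at most the successor of the other. The stage `2 * γ`, for `γ ≥ 1`, is the relation
`x < y + ω ^ γ ∧ y < x + ω ^ γ`, whose classes are the blocks `[ω ^ γ * ξ, ω ^ γ * (ξ + 1))`: taking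
the closure joins each block to the first point of the next one, and the equivalence relation
generated then merges `ω` consecutive blocks (`equivClosure_within_one`,
`equivClosure_closure_near`, `near_limit`). The class is therefore `2 * γ + 1` for `θ = ω ^ γ` and
`2 * γ + 2` for `θ = ω ^ γ + 1`. These are all the nonzero ordinals except the limit ordinals; a
limit ordinal `2 * γ` is reached by the wedge at `0` of all the intervals `[0, ω ^ i]`, `i < γ`, to which
the same description applies coordinatewise.
-/

namespace CPE

/-! ### Bounds for the entropy of a two-element cover -/

section CoverEntropy

variable {G X : Type*} [Group G] [MulAction G X]

theorem refineCover_finite {U : Set (Set X)} (hU : U.Finite) (F : Finset G) :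
    (refineCover U F).Finite := by
  have : Finite U := hU
  refine (Set.finite_range
    (fun ψ : F → U => ⋂ g : F, (fun x : X => (g : G) • x) ⁻¹' (ψ g : Set X))).subset ?_
  rintro V ⟨φ, hφ, rfl⟩
  refine ⟨fun g => ⟨φ g, hφ g g.2⟩, ?_⟩
  ext x
  simp

theorem sUnion_refineCover {U : Set (Set X)} (hU : ⋃₀ U = univ) (F : Finset G) :
    ⋃₀ refineCover U F = univ := by
  refine eq_univ_of_forall fun x => ?_
  have h : ∀ g : G, ∃ V ∈ U, g • x ∈ V := fun g => by
    have : g • x ∈ ⋃₀ U := hU ▸ mem_univ _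
    simpa using this
  choose φ hφ hx using h
  exact ⟨_, ⟨φ, fun g _ => hφ g, rfl⟩, by simpa using fun g _ => hx g⟩

/-- A minimal subcover is attained as soon as the cover is finite. -/
theorem exists_card_eq_minSubcover {U : Set (Set X)} (hfin : U.Finite) (hU : ⋃₀ U = univ) :
    ∃ S : Finset (Set X), (S : Set (Set X)) ⊆ U ∧ ⋃₀ (S : Set (Set X)) = univ ∧
      S.card = minSubcover U :=
  Nat.sInf_mem (s := {n | ∃ S : Finset (Set X), (S : Set (Set X)) ⊆ U ∧
    ⋃₀ (S : Set (Set X)) = univ ∧ S.card = n})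
    ⟨_, hfin.toFinset, by simp, by simpa using hU, rfl⟩

theorem minSubcover_le {U : Set (Set X)} {S : Finset (Set X)} (hS : (S : Set (Set X)) ⊆ U)
    (hcov : ⋃₀ (S : Set (Set X)) = univ) : minSubcover U ≤ S.card :=
  Nat.sInf_le ⟨S, hS, hcov, rfl⟩

/-- If every choice of `A` or `B` at the places `g ∈ S ⊆ F` is realised by a point, then the
refinement of `{Aᶜ, Bᶜ}` along `F` needs at least `2 ^ |S|` members to cover: a member that contains
a realising point determines the choice. -/
theorem two_pow_le_minSubcover {A B : Set X} (hA : A.Nonempty) (hAB : Disjoint A B)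
    {S F : Finset G} (hSF : S ⊆ F)
    (h : ∀ P : Finset G, P ⊆ S → ∃ x : X, ∀ g ∈ S, (g ∈ P → g • x ∈ A) ∧ (g ∉ P → g • x ∈ B)) :
    2 ^ S.card ≤ minSubcover (refineCover ({Aᶜ, Bᶜ} : Set (Set X)) F) := by
  classical
  have hne : Aᶜ ≠ Bᶜ := by
    intro he
    obtain ⟨a, ha⟩ := hA
    exact hAB.le_bot ⟨ha, compl_injective he ▸ ha⟩
  have hcov : ⋃₀ ({Aᶜ, Bᶜ} : Set (Set X)) = univ := by
    rw [sUnion_pair, ← compl_inter, hAB.inter_eq, compl_empty]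
  obtain ⟨C, hCU, hC, hcard⟩ := exists_card_eq_minSubcover
    (refineCover_finite (U := ({Aᶜ, Bᶜ} : Set (Set X))) (by simp) F) (sUnion_refineCover hcov F)
  rw [← hcard, ← Finset.card_powerset]
  have hV : ∀ P : Finset G, ∃ V : Set X, ∃ x : X, P ⊆ S → V ∈ C ∧ x ∈ V ∧
      ∀ g ∈ S, (g ∈ P → g • x ∈ A) ∧ (g ∉ P → g • x ∈ B) := by
    intro P
    by_cases hP : P ⊆ S
    · obtain ⟨x, hx⟩ := h P hP
      obtain ⟨V, hVC, hxV⟩ : x ∈ ⋃₀ (C : Set (Set X)) := hC ▸ mem_univ x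
      exact ⟨V, x, fun _ => ⟨hVC, hxV, hx⟩⟩
    · exact ⟨∅, hA.some, fun h => absurd h hP⟩
  choose V x hVx using hV
  refine Finset.card_le_card_of_injOn V (fun P hP => (hVx P (Finset.mem_powerset.1 hP)).1) ?_
  intro P hP Q hQ hPQ
  have hP' : P ⊆ S := by simpa using hP
  have hQ' : Q ⊆ S := by simpa using hQ
  obtain ⟨hPC, hxP, hP1⟩ := hVx P hP'
  obtain ⟨-, hxQ, hQ1⟩ := hVx Q hQ'
  rw [← hPQ] at hxQ
  obtain ⟨φ, hφ, hVφ⟩ := hCU hPC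
  rw [hVφ] at hxP hxQ
  simp only [mem_iInter, mem_preimage] at hxP hxQ
  have key : ∀ g ∈ S, (g ∈ P ↔ g ∈ Q) := by
    intro g hg
    have h1 := hxP g (hSF hg)
    have h2 := hxQ g (hSF hg)
    rcases hφ g (hSF hg) with he | he
    · rw [he] at h1 h2
      exact ⟨fun h => absurd ((hP1 g hg).1 h) h1, fun h => absurd ((hQ1 g hg).1 h) h2⟩
    · rw [mem_singleton_iff] at he
      rw [he] at h1 h2
      exact ⟨fun _ => by_contra fun h => h2 ((hQ1 g hg).2 h),
        fun _ => by_contra fun h => h1 ((hP1 g hg).2 h)⟩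
  ext g
  exact ⟨fun h => (key g (hP' h)).1 h, fun h => (key g (hQ' h)).2 h⟩

/-- A finite set `F` contains a set `S` of at least `|F| / |D⁻¹ D|` elements whose translates
`D g`, `g ∈ S`, are pairwise disjoint: a maximal one will do. -/
theorem exists_separated_subset [DecidableEq G] (D F : Finset G) (hD : D.Nonempty) :
    ∃ S ⊆ F, (∀ g ∈ S, ∀ g' ∈ S, ∀ d ∈ D, ∀ d' ∈ D, d * g = d' * g' → g = g') ∧
      F.card ≤ (D⁻¹ * D).card * S.card := by
  obtain ⟨S, hS, hmax⟩ := (F.powerset.filter fun S : Finset G =>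
      ∀ g ∈ S, ∀ g' ∈ S, ∀ d ∈ D, ∀ d' ∈ D, d * g = d' * g' → g = g').exists_max_image
    Finset.card ⟨∅, by simp⟩
  rw [Finset.mem_filter, Finset.mem_powerset] at hS
  refine ⟨S, hS.1, hS.2, ?_⟩
  refine (Finset.card_le_card fun f hf => ?_).trans Finset.card_mul_le
  by_cases hfS : f ∈ S
  · obtain ⟨d, hd⟩ := hD
    exact Finset.mem_mul.2 ⟨1, Finset.mem_mul.2
      ⟨d⁻¹, Finset.inv_mem_inv hd, d, hd, by simp⟩, f, hfS, by simp⟩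
  -- otherwise, by maximality, the translate of `D` by `f` meets one by an element of `S`
  by_contra hcon
  have hno : ∀ g ∈ S, ∀ d ∈ D, ∀ d' ∈ D, d * f ≠ d' * g := by
    intro g hg d hd d' hd' he
    refine hcon (Finset.mem_mul.2 ⟨d⁻¹ * d', Finset.mem_mul.2
      ⟨d⁻¹, Finset.inv_mem_inv hd, d', hd', rfl⟩, g, hg, ?_⟩)
    rw [mul_assoc, ← he, inv_mul_cancel_left]
  have := hmax (insert f S) (by
    rw [Finset.mem_filter, Finset.mem_powerset]
    refine ⟨Finset.insert_subset hf hS.1, ?_⟩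
    intro g hg g' hg' d hd d' hd' he
    rcases Finset.mem_insert.1 hg with rfl | hgS <;>
      rcases Finset.mem_insert.1 hg' with rfl | hgS'
    · rfl
    · exact absurd he (hno g' hgS' d hd d' hd')
    · exact absurd he.symm (hno g hgS d' hd' d hd)
    · exact hS.2 g hgS g' hgS' d hd d' hd' he)
  rw [Finset.card_insert_of_notMem hfS] at this
  omega

theorem coverEntropy_pos {F : ℕ → Finset G} (hF : ∀ n, (F n).Nonempty) {U : Set (Set X)} {K : ℕ}
    (h : ∀ n, ∃ s : ℕ, (F n).card ≤ K * s ∧ 2 ^ s ≤ minSubcover (refineCover U (F n))) :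
    0 < coverEntropy F U := by
  have hlog : 0 < Real.log 2 := Real.log_pos one_lt_two
  have hK : 0 < (K : ℝ) := by
    obtain ⟨s, hs, -⟩ := h 0
    have := (hF 0).card_pos
    have : K ≠ 0 := by rintro rfl; omega
    positivity
  have hbound : ((Real.log 2 / K : ℝ) : EReal) ≤ coverEntropy F U := by
    refine le_limsup_of_frequently_le (Eventually.frequently (Eventually.of_forall fun n => ?_))
    obtain ⟨s, hs, hN⟩ := h n
    have hFn : (0 : ℝ) < (F n).card := by exact_mod_cast (hF n).card_pos
    rw [EReal.coe_le_coe_iff, one_div, inv_mul_eq_div, div_le_div_iff₀ hK hFn]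
    have h1 : (s : ℝ) * Real.log 2 ≤ Real.log (minSubcover (refineCover U (F n))) := by
      rw [← Real.log_pow]
      exact Real.log_le_log (by positivity) (by exact_mod_cast hN)
    have h2 : ((F n).card : ℝ) ≤ K * s := by exact_mod_cast hs
    nlinarith
  refine lt_of_lt_of_le ?_ hbound
  exact_mod_cast div_pos hlog hK

/-- In an infinite group the members of a Følner sequence grow without bound, since
`K F n ⊆ F n ∪ (K F n ∆ F n)` has at least `|K|` elements. -/
theorem IsFolnerSeq.tendsto_card [Infinite G] {F : ℕ → Finset G} (hF : IsFolnerSeq F) :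
    Tendsto (fun n => ((F n).card : ℝ)) atTop atTop := by
  classical
  refine tendsto_atTop.2 fun b => ?_
  obtain ⟨m, hm⟩ := exists_nat_ge (2 * b)
  obtain ⟨K, hK⟩ := Infinite.exists_subset_card_eq G (m + 1)
  have hKne : K.Nonempty := Finset.card_pos.1 (by omega)
  filter_upwards [(hF.tendsto K hKne).eventually (gt_mem_nhds one_pos)] with n hn
  have hFn : (0 : ℝ) < (F n).card := by exact_mod_cast (hF.nonempty n).card_pos
  rw [div_lt_one hFn] at hn
  have h1 : (K * F n).card ≤
      (F n).card + (((K : Set G) * (F n : Set G)) ∆ (F n : Set G)).ncard := by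
    rw [← Finset.coe_mul, ← Finset.coe_symmDiff, Set.ncard_coe_finset]
    refine (Finset.card_le_card fun x hx => ?_).trans (Finset.card_union_le _ _)
    by_cases hxF : x ∈ F n
    · exact Finset.mem_union_left _ hxF
    · exact Finset.mem_union_right _ (Finset.mem_symmDiff.2 (Or.inl ⟨hx, hxF⟩))
  have h2 : K.card ≤ (K * F n).card := Finset.card_le_card_mul_right (hF.nonempty n)
  have h3 : (m : ℝ) + 1 ≤
      (F n).card + ((((K : Set G) * (F n : Set G)) ∆ (F n : Set G)).ncard : ℝ) := by
    exact_mod_cast hK ▸ h2.trans h1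
  linarith

/-- If no orbit meets both `A` and `B`, then two members of each refinement of `{Aᶜ, Bᶜ}` suffice
to cover, so the cover has zero entropy. -/
theorem coverEntropy_nonpos [Infinite G] {F : ℕ → Finset G} (hF : IsFolnerSeq F) {A B : Set X}
    (h : ∀ (x : X) (g g' : G), g • x ∈ A → g' • x ∉ B) :
    coverEntropy F ({Aᶜ, Bᶜ} : Set (Set X)) ≤ 0 := by
  classical
  have hN : ∀ n, minSubcover (refineCover ({Aᶜ, Bᶜ} : Set (Set X)) (F n)) ≤ 2 := by
    intro n
    refine (minSubcover_le (S := {⋂ g ∈ F n, (fun x : X => g • x) ⁻¹' Aᶜ,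
      ⋂ g ∈ F n, (fun x : X => g • x) ⁻¹' Bᶜ}) ?_ ?_).trans Finset.card_le_two
    · intro V hV
      simp only [Finset.coe_insert, Finset.coe_singleton, mem_insert_iff, mem_singleton_iff] at hV
      rcases hV with rfl | rfl
      · exact ⟨fun _ => Aᶜ, fun _ _ => by simp, rfl⟩
      · exact ⟨fun _ => Bᶜ, fun _ _ => by simp, rfl⟩
    · refine eq_univ_of_forall fun x => ?_
      simp only [Finset.coe_insert, Finset.coe_singleton, sUnion_insert, sUnion_singleton,
        mem_union, mem_iInter, mem_preimage, mem_compl_iff]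
      by_cases hx : ∃ g ∈ F n, g • x ∈ A
      · obtain ⟨g, -, hg⟩ := hx
        exact Or.inr fun g' _ => h x g g' hg
      · exact Or.inl fun g hg hgx => hx ⟨g, hg, hgx⟩
  have hlim : Tendsto (fun n => ((1 / ((F n).card : ℝ) * Real.log 2 : ℝ) : EReal)) atTop
      (𝓝 0) := by
    have := (hF.tendsto_card.const_div_atTop 1).mul_const (Real.log 2)
    rw [zero_mul] at this
    exact (continuous_coe_real_ereal.tendsto 0).comp this
  rw [← hlim.limsup_eq]
  refine limsup_le_limsup (Eventually.of_forall fun n => ?_)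
  have h1 : Real.log (minSubcover (refineCover ({Aᶜ, Bᶜ} : Set (Set X)) (F n))) ≤ Real.log 2 := by
    rcases Nat.eq_zero_or_pos (minSubcover (refineCover ({Aᶜ, Bᶜ} : Set (Set X)) (F n)))
      with h0 | h0
    · rw [h0, Nat.cast_zero, Real.log_zero]
      exact (Real.log_pos one_lt_two).le
    · exact Real.log_le_log (by exact_mod_cast h0) (by exact_mod_cast hN n)
  rw [EReal.coe_le_coe_iff]
  gcongr

end CoverEntropy

/-! ### General properties of the hierarchy -/

section Hierarchy

theorem equivClosure_subset {X : Type*} {R S : Set (X × X)}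
    (hS : Equivalence fun x y => (x, y) ∈ S)
    (h : R ⊆ S) : equivClosure R ⊆ S := by
  rintro ⟨x, y⟩ (hxy : Relation.EqvGen _ x y)
  induction hxy with
  | rel x y hxy => exact h hxy
  | refl x => exact hS.refl x
  | symm x y _ ih => exact hS.symm ih
  | trans x y z _ _ ih₁ ih₂ => exact hS.trans ih₁ ih₂

theorem subset_equivClosure {X : Type*} (R : Set (X × X)) : R ⊆ equivClosure R :=
  fun p hp => Relation.EqvGen.rel p.1 p.2 hp

theorem equivalence_equivClosure {X : Type*} (R : Set (X × X)) :
    Equivalence fun x y => (x, y) ∈ equivClosure R :=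
  Relation.EqvGen.is_equivalence _

variable {G X : Type*} [Group G] [MulAction G X] [TopologicalSpace X] (F : ℕ → Finset G)

theorem entropyHierarchy_zero : entropyHierarchy X F 0 = ∅ :=
  Ordinal.limitRecOn_zero ..

theorem entropyHierarchy_one : entropyHierarchy X F 1 = entropyPairs X F ∪ diagonal X := by
  have := Ordinal.limitRecOn_add_one (motive := fun _ => Set (X × X)) 0 ∅
  rw [zero_add] at this
  exact (this _ _).trans (if_pos rfl)

open Classical in
theorem entropyHierarchy_add_one {β : Ordinal} (hβ : β ≠ 0) :
    entropyHierarchy X F (β + 1) = if IsClosed (entropyHierarchy X F β) then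
      equivClosure (entropyHierarchy X F β) else closure (entropyHierarchy X F β) :=
  (Ordinal.limitRecOn_add_one ..).trans (if_neg hβ)

theorem entropyHierarchy_limit {β : Ordinal} (hβ : Order.IsSuccLimit β) :
    entropyHierarchy X F β = ⋃ (γ : Ordinal) (_ : γ < β), entropyHierarchy X F γ :=
  Ordinal.limitRecOn_limit _ _ _ _ hβ

theorem entropyHierarchy_subset_add_one (β : Ordinal) :
    entropyHierarchy X F β ⊆ entropyHierarchy X F (β + 1) := by
  classical
  rcases eq_or_ne β 0 with rfl | hβ
  · rw [entropyHierarchy_zero]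
    exact empty_subset _
  rw [entropyHierarchy_add_one F hβ]
  split_ifs
  · exact subset_equivClosure _
  · exact subset_closure

theorem entropyHierarchy_mono : Monotone (entropyHierarchy X F) := by
  intro α β h
  induction β using Ordinal.limitRecOn with
  | zero => rw [nonpos_iff_eq_zero.1 h]
  | add_one β ih =>
    rcases h.eq_or_lt with rfl | h
    · exact le_rfl
    · exact (ih (Order.lt_add_one_iff.1 h)).trans (entropyHierarchy_subset_add_one F β)
  | limit β hβ ih =>
    rcases h.eq_or_lt with rfl | h
    · exact le_rfl
    · rw [entropyHierarchy_limit F hβ]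
      exact subset_biUnion_of_mem (u := fun γ => entropyHierarchy X F γ) h

/-- One step after an equivalence relation the hierarchy is at its closure, whether or not the
relation is closed. -/
theorem entropyHierarchy_add_one_of_equivalence {β : Ordinal} (hβ : β ≠ 0)
    (h : Equivalence fun x y => (x, y) ∈ entropyHierarchy X F β) :
    entropyHierarchy X F (β + 1) = closure (entropyHierarchy X F β) := by
  classical
  rw [entropyHierarchy_add_one F hβ]
  split_ifs with hc
  · rw [hc.closure_eq]
    exact (equivClosure_subset h subset_rfl).antisymm (subset_equivClosure _)
  · rfl

theorem entropyHierarchy_add_one_of_isClosed {β : Ordinal} (hβ : β ≠ 0)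
    (h : IsClosed (entropyHierarchy X F β)) :
    entropyHierarchy X F (β + 1) = equivClosure (entropyHierarchy X F β) := by
  classical
  rw [entropyHierarchy_add_one F hβ, if_pos h]

end Hierarchy

/-! ### Clique shifts -/

/-- The clique shift of a relation `R` on `Y`: the configurations `u : G → Y` whose values are
pairwise `R`-related. -/
def CliqueShift (G : Type*) {Y : Type*} (R : Set (Y × Y)) : Type _ :=
  {u : G → Y // ∀ g h, (u g, u h) ∈ R}

namespace CliqueShift

variable {G Y : Type*} {R : Set (Y × Y)}

instance : CoeFun (CliqueShift G R) fun _ => G → Y := ⟨Subtype.val⟩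

theorem rel (u : CliqueShift G R) (g h : G) : (u g, u h) ∈ R := u.2 g h

/-- The constant configuration at a point `y`. -/
def const (hR : ∀ y, (y, y) ∈ R) (y : Y) : CliqueShift G R := ⟨fun _ => y, fun _ _ => hR y⟩

@[simp] theorem const_apply (hR : ∀ y, (y, y) ∈ R) (y : Y) (g : G) :
    (const hR y : CliqueShift G R) g = y := rfl

instance [TopologicalSpace Y] : TopologicalSpace (CliqueShift G R) :=
  inferInstanceAs (TopologicalSpace {u : G → Y // ∀ g h, (u g, u h) ∈ R})

theorem continuous_apply [TopologicalSpace Y] (g : G) :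
    Continuous fun u : CliqueShift G R => u g :=
  (_root_.continuous_apply g).comp continuous_subtype_val

theorem continuous_const [TopologicalSpace Y] (hR : ∀ y, (y, y) ∈ R) :
    Continuous (const hR : Y → CliqueShift G R) :=
  Continuous.subtype_mk (continuous_pi fun _ => continuous_id) _

theorem isEmbedding_coe [TopologicalSpace Y] :
    IsEmbedding fun u : CliqueShift G R => (u : G → Y) :=
  IsEmbedding.subtypeVal

instance [Countable G] [TopologicalSpace Y] [SecondCountableTopology Y] :
    SecondCountableTopology (CliqueShift G R) :=
  isEmbedding_coe.isInducing.secondCountableTopology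

instance [TopologicalSpace Y] [T2Space Y] : T2Space (CliqueShift G R) :=
  isEmbedding_coe.t2Space

theorem compactSpace [TopologicalSpace Y] [CompactSpace Y] (hR : IsClosed R) :
    CompactSpace (CliqueShift G R) := by
  have : IsClosed {u : G → Y | ∀ g h, (u g, u h) ∈ R} := by
    simp only [ofPred_forall]
    exact isClosed_iInter fun g => isClosed_iInter fun h =>
      hR.preimage ((_root_.continuous_apply g).prodMk (_root_.continuous_apply h))
  exact isCompact_iff_compactSpace.1 this.isCompact

/-- Membership in a neighbourhood of `u` is guaranteed by agreement with `u` on a suitable finite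
set of coordinates. -/
theorem exists_finset_forall_mem [TopologicalSpace Y] {u : CliqueShift G R}
    {A : Set (CliqueShift G R)} (hA : A ∈ 𝓝 u) :
    ∃ D : Finset G, ∀ w : CliqueShift G R, (∀ d ∈ D, w d = u d) → w ∈ A := by
  classical
  rw [isEmbedding_coe.nhds_eq_comap, mem_comap] at hA
  obtain ⟨t, ht, htA⟩ := hA
  rw [nhds_pi, Filter.mem_pi] at ht
  obtain ⟨I, hI, s, hs, hst⟩ := ht
  refine ⟨hI.toFinset, fun w hw => htA (hst fun i hi => ?_)⟩
  change w i ∈ s i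
  rw [hw i (hI.mem_toFinset.2 hi)]
  exact mem_of_mem_nhds (hs i)

/-- The pairs of configurations whose values, taken together, are pairwise `R`-related. -/
def jointCliques (G : Type*) {Y : Type*} (R : Set (Y × Y)) :
    Set (CliqueShift G R × CliqueShift G R) :=
  {p | ∀ g h, (p.1 g, p.2 h) ∈ R}

theorem isClosed_jointCliques [TopologicalSpace Y] (hR : IsClosed R) :
    IsClosed (jointCliques G R) := by
  simp only [jointCliques, ofPred_forall]
  exact isClosed_iInter fun g => isClosed_iInter fun h =>
    hR.preimage (((continuous_apply g).comp continuous_fst).prodMk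
      ((continuous_apply h).comp continuous_snd))

variable [Group G]

/-- The group acts by right translation of the argument, which is a left action. -/
instance : MulAction G (CliqueShift G R) where
  smul g u := ⟨fun h => u (h * g), fun _ _ => u.rel _ _⟩
  one_smul u := Subtype.ext (funext fun h => congrArg u (mul_one h))
  mul_smul g g' u := Subtype.ext (funext fun h => congrArg u (mul_assoc h g g').symm)

/-- The pairs of configurations whose values at the identity are `Q`-related. -/
def pullback (G : Type*) [Group G] {Y : Type*} (R Q : Set (Y × Y)) :
    Set (CliqueShift G R × CliqueShift G R) :=
  {p | (p.1 1, p.2 1) ∈ Q}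

theorem pullback_ne_univ (hrefl : ∀ y, (y, y) ∈ R) {Q : Set (Y × Y)} {y z : Y}
    (h : (y, z) ∉ Q) : pullback G R Q ≠ univ := by
  intro hu
  have : (const hrefl y, const hrefl z) ∈ pullback G R Q := hu ▸ mem_univ _
  exact h this

theorem equivalence_pullback {Q : Set (Y × Y)} (hQ : Equivalence fun y z => (y, z) ∈ Q) :
    Equivalence fun u v => (u, v) ∈ pullback G R Q :=
  ⟨fun u => hQ.refl (u 1), fun h => hQ.symm h, fun h h' => hQ.trans h h'⟩

theorem pullback_mono {Q Q' : Set (Y × Y)} (h : Q ⊆ Q') : pullback G R Q ⊆ pullback G R Q' :=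
  fun _ hp => h hp

/-- An equivalence relation on the clique shift that identifies each configuration with the constant
one at its value, and that relates the constant configurations at `Q`-related points, contains
the pullback of the equivalence relation generated by `Q`. -/
theorem pullback_equivClosure_subset (hrefl : ∀ y, (y, y) ∈ R) {Q : Set (Y × Y)}
    {T : Set (CliqueShift G R × CliqueShift G R)} (hT : Equivalence fun u v => (u, v) ∈ T)
    (hconst : ∀ u : CliqueShift G R, (u, const hrefl (u 1)) ∈ T)
    (hQ : ∀ y z, (y, z) ∈ Q → (const hrefl y, const hrefl z) ∈ T) :
    pullback G R (equivClosure Q) ⊆ T := by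
  rintro ⟨u, v⟩ (huv : (u 1, v 1) ∈ equivClosure Q)
  have : (const hrefl (u 1), const hrefl (v 1)) ∈ T :=
    equivClosure_subset (S := {p | (const hrefl p.1, const hrefl p.2) ∈ T})
      ⟨fun y => hT.refl _, fun h => hT.symm h, fun h h' => hT.trans h h'⟩
      (fun p hp => hQ p.1 p.2 hp) huv
  exact hT.trans (hconst u) (hT.trans this (hT.symm (hconst v)))

theorem equivClosure_jointCliques (hrefl : ∀ y, (y, y) ∈ R) :
    equivClosure (jointCliques G R) = pullback G R (equivClosure R) := by
  refine (equivClosure_subset (equivalence_pullback (G := G) (equivalence_equivClosure R))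
    fun p (hp : ∀ g h, (p.1 g, p.2 h) ∈ R) => subset_equivClosure R (hp 1 1)).antisymm ?_
  refine pullback_equivClosure_subset hrefl (equivalence_equivClosure _)
    (fun u => subset_equivClosure _ fun g _ => u.rel g 1)
    (fun y z hyz => subset_equivClosure _ fun _ _ => hyz)

variable [TopologicalSpace Y]

instance : ContinuousConstSMul G (CliqueShift G R) where
  continuous_const_smul g :=
    Continuous.subtype_mk (continuous_pi fun h => continuous_apply (h * g)) _

/-- Two distinct configurations with jointly pairwise related values form an entropy pair: on a
large subset of a finite set of places the patterns of the two can be chosen independently. -/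
theorem mem_entropyPairs {F : ℕ → Finset G} (hF : ∀ n, (F n).Nonempty)
    (hsymm : ∀ y z, (y, z) ∈ R → (z, y) ∈ R) {u v : CliqueShift G R} (huv : u ≠ v)
    (h : (u, v) ∈ jointCliques G R) : (u, v) ∈ entropyPairs (CliqueShift G R) F := by
  classical
  refine ⟨huv, fun A B _ _ hA hB hAB => ?_⟩
  obtain ⟨D₁, hD₁⟩ := exists_finset_forall_mem hA
  obtain ⟨D₂, hD₂⟩ := exists_finset_forall_mem hB
  -- the element `1` only serves to make the window nonempty
  have hD : (insert 1 (D₁ ∪ D₂)).Nonempty := Finset.insert_nonempty _ _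
  set D := insert 1 (D₁ ∪ D₂) with hDdef
  refine coverEntropy_pos hF (K := (D⁻¹ * D).card) fun n => ?_
  obtain ⟨S, hSF, hS, hcard⟩ := exists_separated_subset D (F n) hD
  refine ⟨S.card, hcard, two_pow_le_minSubcover ⟨u, mem_of_mem_nhds hA⟩ hAB hSF fun P hP => ?_⟩
  -- the pattern of `u` at the places of `P` and that of `v` at the other places of `S`
  let w : G → Y := fun x => if hx : ∃ g ∈ S, ∃ d ∈ D, d * g = x then
    if hx.choose ∈ P then u (x * hx.choose⁻¹) else v (x * hx.choose⁻¹) else u 1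
  have hval : ∀ x, (∃ a, w x = u a) ∨ ∃ a, w x = v a := by
    intro x
    by_cases hx : ∃ g ∈ S, ∃ d ∈ D, d * g = x
    · by_cases hP : hx.choose ∈ P
      · exact Or.inl ⟨_, by simp only [w]; rw [dif_pos hx, if_pos hP]⟩
      · exact Or.inr ⟨_, by simp only [w]; rw [dif_pos hx, if_neg hP]⟩
    · exact Or.inl ⟨_, dif_neg hx⟩
  have hw : ∀ x y, (w x, w y) ∈ R := by
    intro x y
    rcases hval x with ⟨a, ha⟩ | ⟨a, ha⟩ <;> rcases hval y with ⟨b, hb⟩ | ⟨b, hb⟩ <;> rw [ha, hb]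
    · exact u.rel a b
    · exact h a b
    · exact hsymm _ _ (h b a)
    · exact v.rel a b
  have hwD : ∀ g ∈ S, ∀ d ∈ D, w (d * g) = if g ∈ P then u d else v d := by
    intro g hg d hd
    have hx : ∃ g' ∈ S, ∃ d' ∈ D, d' * g' = d * g := ⟨g, hg, d, hd, rfl⟩
    have hgx : hx.choose = g := by
      obtain ⟨h1, d', hd', h2⟩ := hx.choose_spec
      exact hS _ h1 _ hg d' hd' d hd h2
    simp only [w]
    rw [dif_pos hx, hgx, mul_inv_cancel_right]
  refine ⟨⟨w, hw⟩, fun g hg => ⟨fun hgP => hD₁ _ fun d hd => ?_, fun hgP => hD₂ _ fun d hd => ?_⟩⟩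
  · exact (hwD g hg d (by simp [hDdef, hd])).trans (if_pos hgP)
  · exact (hwD g hg d (by simp [hDdef, hd])).trans (if_neg hgP)

/-- If some value of `u` is not related to some value of `v`, then `u` and `v` have closed
neighbourhoods that no orbit meets both, so they are not an entropy pair. -/
theorem entropyPairs_subset [T2Space Y] [CompactSpace Y] [Infinite G] {F : ℕ → Finset G}
    (hF : IsFolnerSeq F) (hR : IsClosed R) :
    entropyPairs (CliqueShift G R) F ⊆ jointCliques G R := by
  rintro ⟨u, v⟩ ⟨huv, h⟩ a b
  by_contra hab
  change (u a, v b) ∉ R at hab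
  obtain ⟨s, hs, t, ht, hst⟩ := mem_nhds_prod_iff.1 (hR.isOpen_compl.mem_nhds hab)
  obtain ⟨s', hs', hsc, hss⟩ := exists_mem_nhds_isClosed_subset hs
  obtain ⟨t', ht', htc, htt⟩ := exists_mem_nhds_isClosed_subset ht
  have hsep : ∀ y ∈ s', ∀ z ∈ t', (y, z) ∉ R := fun y hy z hz =>
    hst (mk_mem_prod (hss hy) (htt hz))
  refine (h ((fun w : CliqueShift G R => w a) ⁻¹' s') ((fun w : CliqueShift G R => w b) ⁻¹' t')
    (hsc.preimage (continuous_apply a)) (htc.preimage (continuous_apply b))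
    ((continuous_apply a).continuousAt hs') ((continuous_apply b).continuousAt ht')
    (disjoint_left.2 fun w hwa hwb => hsep _ hwa _ hwb (w.rel a b))).not_ge ?_
  exact coverEntropy_nonpos hF fun w g g' hg hg' => hsep _ hg _ hg' (w.rel (a * g) (b * g'))

theorem entropyHierarchy_one [T2Space Y] [CompactSpace Y] [Infinite G] {F : ℕ → Finset G}
    (hF : IsFolnerSeq F) (hR : IsClosed R)
    (hsymm : ∀ y z, (y, z) ∈ R → (z, y) ∈ R) :
    entropyHierarchy (CliqueShift G R) F 1 = jointCliques G R := by
  rw [CPE.entropyHierarchy_one]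
  refine (union_subset (entropyPairs_subset hF hR) ?_).antisymm ?_
  · rintro ⟨u, v⟩ (rfl : u = v)
    exact u.rel
  · rintro ⟨u, v⟩ h
    by_cases huv : u = v
    · exact Or.inr huv
    · exact Or.inl (mem_entropyPairs hF.nonempty hsymm huv h)

theorem continuous_eval_one :
    Continuous fun p : CliqueShift G R × CliqueShift G R => (p.1 1, p.2 1) :=
  ((continuous_apply 1).comp continuous_fst).prodMk ((continuous_apply 1).comp continuous_snd)

theorem closure_pullback_subset (Q : Set (Y × Y)) :
    closure (pullback G R Q) ⊆ pullback G R (closure Q) :=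
  closure_minimal (pullback_mono subset_closure) (isClosed_closure.preimage continuous_eval_one)

theorem equivClosure_closure_pullback (hrefl : ∀ y, (y, y) ∈ R) {Q : Set (Y × Y)}
    (hQ : ∀ y, (y, y) ∈ Q) :
    equivClosure (closure (pullback G R Q)) = pullback G R (equivClosure (closure Q)) := by
  refine (equivClosure_subset (equivalence_pullback (equivalence_equivClosure _)) ?_).antisymm ?_
  · exact (closure_pullback_subset Q).trans (pullback_mono (subset_equivClosure _))
  refine pullback_equivClosure_subset hrefl (equivalence_equivClosure _)
    (fun u => subset_equivClosure _ (subset_closure (hQ (u 1))))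
    (fun y z hyz => subset_equivClosure _ ?_)
  exact map_mem_closure (f := fun p : Y × Y => (const hrefl p.1, const hrefl p.2))
    (((continuous_const hrefl).comp continuous_fst).prodMk
    ((continuous_const hrefl).comp continuous_snd)) hyz fun p hp => hp

/-- If the relations `Q γ`, `γ ≥ 1`, on the alphabet arise from `R` by alternating closure and
generated equivalence relation, then they determine the hierarchy of the clique shift at the even
ordinals `2 * γ`. -/
theorem entropyHierarchy_two_mul [T2Space Y] [CompactSpace Y] [Infinite G] {F : ℕ → Finset G}
    (hF : IsFolnerSeq F) (hR : IsClosed R) (hrefl : ∀ y, (y, y) ∈ R)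
    (hsymm : ∀ y z, (y, z) ∈ R → (z, y) ∈ R) {Q : Ordinal.{v} → Set (Y × Y)}
    (hQ : ∀ γ, Equivalence fun y z => (y, z) ∈ Q γ) (hone : equivClosure R = Q 1)
    (hadd : ∀ γ, 1 ≤ γ → equivClosure (closure (Q γ)) = Q (γ + 1))
    (hlim : ∀ γ, Order.IsSuccLimit γ → Q γ = ⋃ (δ : Ordinal) (_ : 1 ≤ δ) (_ : δ < γ), Q δ)
    {γ : Ordinal.{v}} (hγ : 1 ≤ γ) :
    entropyHierarchy (CliqueShift G R) F (2 * γ) = pullback G R (Q γ) := by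
  induction γ using Ordinal.limitRecOn with
  | zero => simp at hγ
  | add_one γ ih =>
    rcases eq_or_ne γ 0 with rfl | hγ0
    · rw [zero_add, mul_one, ← one_add_one_eq_two,
        entropyHierarchy_add_one_of_isClosed F one_ne_zero]
      · rw [entropyHierarchy_one hF hR hsymm, equivClosure_jointCliques hrefl, hone]
      · rw [entropyHierarchy_one hF hR hsymm]
        exact isClosed_jointCliques hR
    · have h1 : 1 ≤ γ := Order.one_le_iff_pos.2 (pos_iff_ne_zero.2 hγ0)
      have h2 : 2 * γ ≠ 0 := mul_ne_zero two_ne_zero hγ0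
      have hcl : entropyHierarchy (CliqueShift G R) F (2 * γ + 1) =
          closure (pullback G R (Q γ)) := by
        rw [entropyHierarchy_add_one_of_equivalence F h2, ih h1]
        rw [ih h1]
        exact equivalence_pullback (hQ γ)
      rw [mul_add, mul_one, ← one_add_one_eq_two, ← add_assoc, one_add_one_eq_two,
        entropyHierarchy_add_one_of_isClosed F (by simp), hcl,
        equivClosure_closure_pullback hrefl fun y => (hQ γ).refl y, hadd γ h1]
      rw [hcl]
      exact isClosed_closure
  | limit γ hγl ih =>
    rw [entropyHierarchy_limit F (Ordinal.isSuccLimit_mul_right (by simp) hγl), hlim γ hγl]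
    refine Subset.antisymm (iUnion₂_subset fun β hβ => ?_) ?_
    · obtain ⟨δ, hδ, hβδ⟩ := (Ordinal.lt_mul_iff_of_isSuccLimit hγl).1 hβ
      have hδ1 : δ + 1 < γ := hγl.add_one_lt hδ
      refine (entropyHierarchy_mono F
        (hβδ.le.trans (mul_le_mul_right (Order.le_succ δ) 2))).trans ?_
      rw [Order.succ_eq_add_one, ih _ hδ1 (by simp)]
      intro p hp
      exact mem_iUnion.2 ⟨δ + 1, mem_iUnion₂.2 ⟨by simp, hδ1, hp⟩⟩
    · rintro ⟨u, v⟩ huv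
      change (u 1, v 1) ∈ ⋃ (δ : Ordinal) (_ : 1 ≤ δ) (_ : δ < γ), Q δ at huv
      simp only [mem_iUnion] at huv
      obtain ⟨δ, h1, hδ, h⟩ := huv
      have : (u, v) ∈ pullback G R (Q δ) := h
      rw [← ih δ hδ h1] at this
      exact mem_iUnion₂.2 ⟨2 * δ, mul_lt_mul_of_pos_left hδ two_pos, this⟩

theorem entropyHierarchy_two_mul_add_one [T2Space Y] [CompactSpace Y] [Infinite G]
    {F : ℕ → Finset G}
    (hF : IsFolnerSeq F) (hR : IsClosed R) (hrefl : ∀ y, (y, y) ∈ R)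
    (hsymm : ∀ y z, (y, z) ∈ R → (z, y) ∈ R) {Q : Ordinal.{v} → Set (Y × Y)}
    (hQ : ∀ γ, Equivalence fun y z => (y, z) ∈ Q γ) (hone : equivClosure R = Q 1)
    (hadd : ∀ γ, 1 ≤ γ → equivClosure (closure (Q γ)) = Q (γ + 1))
    (hlim : ∀ γ, Order.IsSuccLimit γ → Q γ = ⋃ (δ : Ordinal) (_ : 1 ≤ δ) (_ : δ < γ), Q δ)
    {γ : Ordinal.{v}} (hγ : 1 ≤ γ) :
    entropyHierarchy (CliqueShift G R) F (2 * γ + 1) = closure (pullback G R (Q γ)) := by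
  have h2 : 2 * γ ≠ 0 := mul_ne_zero two_ne_zero (pos_iff_ne_zero.1 (Order.one_le_iff_pos.1 hγ))
  have h := entropyHierarchy_two_mul hF hR hrefl hsymm hQ hone hadd hlim hγ
  rw [entropyHierarchy_add_one_of_equivalence F h2, h]
  rw [h]
  exact equivalence_pullback (hQ γ)

end CliqueShift

open Ordinal hiding univ

/-! ### Wedges of ordinal intervals -/

/-- Adding `c` is not continuous, but it only jumps upwards at limits. -/
theorem isClosed_le_add (c : Ordinal.{v}) :
    IsClosed {p : Ordinal.{v} × Ordinal.{v} | p.1 ≤ p.2 + c} := by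
  refine isOpen_compl_iff.1 (isOpen_iff_mem_nhds.2 ?_)
  rintro ⟨a, b⟩ hab
  have hab : b + c < a := not_le.1 hab
  filter_upwards [prod_mem_nhds (Ioi_mem_nhds hab) (Iio_mem_nhds (lt_add_one b))]
  rintro ⟨a', b'⟩ ⟨ha, hb⟩ (h : a' ≤ b' + c)
  have hb' : b' ≤ b := Order.lt_add_one_iff.1 hb
  exact (h.trans (by gcongr)).not_gt ha

/-- Being less than `ω ^ γ` above is transitive, since `ω ^ γ` absorbs smaller ordinals on its
left. -/
theorem add_omega0_opow_le {a b γ : Ordinal.{v}} (h : a < b + ω ^ γ) : a + ω ^ γ ≤ b + ω ^ γ := by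
  rcases le_total a b with hab | hab
  · gcongr
  · rw [← Ordinal.add_sub_cancel_of_le hab] at h ⊢
    rw [add_assoc, add_omega0_opow (lt_of_add_lt_add_left h)]

variable {ι : Type*}

/-- The wedge at `0` of the ordinal intervals `[0, θ i]`, as the set of the points of the product
that have at most one nonzero coordinate. -/
def wedge (θ : ι → Ordinal.{v}) : Set (ι → Ordinal.{v}) :=
  {x | (∀ i, x i ≤ θ i) ∧ ∀ i j, i ≠ j → x i = 0 ∨ x j = 0}

theorem isCompact_wedge (θ : ι → Ordinal.{v}) : IsCompact (wedge θ) := by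
  refine (isCompact_univ_pi fun i => isCompact_Icc (a := 0) (b := θ i)).of_isClosed_subset ?_
    fun x hx i _ => ⟨zero_le, hx.1 i⟩
  simp only [wedge, ofPred_and, ofPred_forall]
  refine (isClosed_iInter fun i => isClosed_le (continuous_apply i) continuous_const).inter
    (isClosed_iInter fun i => isClosed_iInter fun j => isClosed_iInter fun _ => ?_)
  exact (isClosed_eq (continuous_apply i) continuous_const).union
    (isClosed_eq (continuous_apply j) continuous_const)

theorem countable_Iic {a : Ordinal.{v}} (ha : a.card ≤ ℵ₀) : (Iic a).Countable := by
  rw [← Order.Iio_succ, Order.succ_eq_add_one, ← Cardinal.le_aleph0_iff_set_countable,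
    Cardinal.mk_Iio_ordinal,
    Cardinal.lift_le_aleph0, Ordinal.card_add, Ordinal.card_one]
  exact Cardinal.add_le_aleph0.2 ⟨ha, Cardinal.one_le_aleph0⟩

theorem secondCountableTopology_Iic {a : Ordinal.{v}} (ha : a.card ≤ ℵ₀) :
    SecondCountableTopology (Iic a) := by
  have : Countable (Iic a) := countable_Iic ha
  refine ⟨⟨{s | ∃ b : Iic a, s = Ioi b ∨ s = Iio b}, ?_,
    OrderTopology.topology_eq_generate_intervals⟩⟩
  have : {s : Set (Iic a) | ∃ b : Iic a, s = Ioi b ∨ s = Iio b} = range Ioi ∪ range Iio := by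
    ext s
    simp only [mem_ofPred_eq, mem_union, mem_range, eq_comm (a := s)]
    exact exists_or
  rw [this]
  exact (countable_range _).union (countable_range _)

theorem secondCountableTopology_wedge [Countable ι] {θ : ι → Ordinal.{v}}
    (hθ : ∀ i, (θ i).card ≤ ℵ₀) :
    SecondCountableTopology (wedge θ) := by
  have : ∀ i, SecondCountableTopology (Iic (θ i)) := fun i => secondCountableTopology_Iic (hθ i)
  have h1 : IsEmbedding fun (x : ∀ i, Iic (θ i)) (i : ι) => (x i : Ordinal.{v}) :=
    IsEmbedding.piMap fun _ => IsEmbedding.subtypeVal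
  have h2 : IsEmbedding fun (x : wedge θ) (i : ι) => (⟨x.1 i, x.2.1 i⟩ : Iic (θ i)) :=
    IsEmbedding.of_comp (continuous_pi fun i => Continuous.subtype_mk
      ((continuous_apply i).comp continuous_subtype_val) _) h1.continuous IsEmbedding.subtypeVal
  exact h2.isInducing.secondCountableTopology

theorem t2Space_of_homeomorph_wedge {Y : Type*} [TopologicalSpace Y] {θ : ι → Ordinal.{v}}
    (e : Y ≃ₜ wedge θ) : T2Space Y :=
  e.isEmbedding.t2Space

theorem compactSpace_of_homeomorph_wedge {Y : Type*} [TopologicalSpace Y] {θ : ι → Ordinal.{v}}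
    (e : Y ≃ₜ wedge θ) : CompactSpace Y :=
  have := isCompact_iff_compactSpace.1 (isCompact_wedge θ)
  e.symm.compactSpace

/-! ### Closeness relations on a wedge -/

section Relations

variable {Y : Type*} [TopologicalSpace Y] {θ : ι → Ordinal.{v}} (e : Y ≃ₜ wedge θ)

theorem continuous_coord (i : ι) : Continuous fun y => (e y : ι → Ordinal.{v}) i :=
  (continuous_apply i).comp (continuous_subtype_val.comp e.continuous)

/-- The pairs of points each coordinate of which is at most the sum of that of the other
and `c`. -/
def within (c : Ordinal.{v}) : Set (Y × Y) :=
  {p | ∀ i, (e p.1).1 i ≤ (e p.2).1 i + c ∧ (e p.2).1 i ≤ (e p.1).1 i + c}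

/-- The pairs of points each coordinate of which is less than the sum of that of the other
and `c`. -/
def near (c : Ordinal.{v}) : Set (Y × Y) :=
  {p | ∀ i, (e p.1).1 i < (e p.2).1 i + c ∧ (e p.2).1 i < (e p.1).1 i + c}

theorem isClosed_within (c : Ordinal.{v}) : IsClosed (within e c) := by
  simp only [within, ofPred_forall, ofPred_and]
  refine isClosed_iInter fun i => IsClosed.inter ?_ ?_
  · exact (isClosed_le_add c).preimage (((continuous_coord e i).comp continuous_fst).prodMk
      ((continuous_coord e i).comp continuous_snd))
  · exact (isClosed_le_add c).preimage (((continuous_coord e i).comp continuous_snd).prodMk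
      ((continuous_coord e i).comp continuous_fst))

theorem within_refl (c : Ordinal.{v}) (y : Y) : (y, y) ∈ within e c :=
  fun _ => ⟨le_self_add, le_self_add⟩

theorem within_symm (c : Ordinal.{v}) (y z : Y) (h : (y, z) ∈ within e c) : (z, y) ∈ within e c :=
  fun i => (h i).symm

theorem near_subset_within (c : Ordinal.{v}) : near e c ⊆ within e c :=
  fun _ h i => ⟨(h i).1.le, (h i).2.le⟩

theorem within_subset_near {c d : Ordinal.{v}} (h : c < d) : within e c ⊆ near e d :=
  fun _ hp i => ⟨(hp i).1.trans_lt (by gcongr), (hp i).2.trans_lt (by gcongr)⟩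

theorem near_mono {c d : Ordinal.{v}} (h : c ≤ d) : near e c ⊆ near e d :=
  fun _ hp i => ⟨(hp i).1.trans_le (by gcongr), (hp i).2.trans_le (by gcongr)⟩

theorem equivalence_near (γ : Ordinal.{v}) : Equivalence fun y z => (y, z) ∈ near e (ω ^ γ) where
  refl _ _ := by simp [opow_pos _ omega0_pos]
  symm h i := (h i).symm
  trans h h' i := ⟨(h i).1.trans_le (add_omega0_opow_le (h' i).1),
    (h' i).2.trans_le (add_omega0_opow_le (h i).2)⟩

variable [DecidableEq ι]

theorem single_mem_wedge {θ : ι → Ordinal.{v}} {i : ι} {ξ : Ordinal.{v}} (h : ξ ≤ θ i) :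
    Pi.single i ξ ∈ wedge θ := by
  refine ⟨fun j => ?_, fun j k hjk => ?_⟩
  · rcases eq_or_ne j i with rfl | hj
    · simpa using h
    · simp [hj]
  · rcases eq_or_ne j i with rfl | hj
    · exact Or.inr (by simp [hjk.symm])
    · exact Or.inl (by simp [hj])

theorem exists_eq_single [Nonempty ι] {θ x : ι → Ordinal.{v}} (hx : x ∈ wedge θ) :
    ∃ i, x = Pi.single i (x i) := by
  by_cases h : ∃ i, x i ≠ 0
  · obtain ⟨i, hi⟩ := h
    refine ⟨i, funext fun j => ?_⟩
    rcases eq_or_ne j i with rfl | hj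
    · simp
    · simpa [hj] using (hx.2 i j hj.symm).resolve_left hi
  · push Not at h
    exact ⟨Classical.arbitrary ι, funext fun j => by simp [h]⟩

theorem countable_wedge [Countable ι] [Nonempty ι] {θ : ι → Ordinal.{v}}
    (hθ : ∀ i, (θ i).card ≤ ℵ₀) : (wedge θ).Countable := by
  refine (countable_iUnion fun i : ι =>
    (countable_Iic (hθ i)).image fun ξ => Pi.single i ξ).mono fun x hx => ?_
  obtain ⟨i, hi⟩ := exists_eq_single hx
  exact mem_iUnion.2 ⟨i, x i, hx.1 i, hi.symm⟩

/-- The point of the `i`-th interval at `min ξ (θ i)`, in a space `Y` homeomorphic to the wedge. -/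
noncomputable def spike (i : ι) (ξ : Ordinal.{v}) : Y :=
  e.symm ⟨Pi.single i (min ξ (θ i)), single_mem_wedge (min_le_right _ _)⟩

theorem apply_spike {i : ι} {ξ : Ordinal.{v}} (h : ξ ≤ θ i) :
    (e (spike e i ξ) : ι → Ordinal.{v}) = Pi.single i ξ := by
  simp [spike, h]

theorem exists_eq_spike [Nonempty ι] (y : Y) : ∃ i, ∃ ξ ≤ θ i, y = spike e i ξ := by
  obtain ⟨i, hi⟩ := exists_eq_single (e y).2
  refine ⟨i, _, (e y).2.1 i, e.injective (Subtype.ext ?_)⟩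
  rw [apply_spike e ((e y).2.1 i)]
  exact hi

theorem spike_zero (i j : ι) : spike e i 0 = spike e j 0 := by
  simp [spike]

theorem continuous_spike (i : ι) : Continuous (spike e i) :=
  e.symm.continuous.comp <| Continuous.subtype_mk
    (f := fun ξ : Ordinal.{v} => (Pi.single i (min ξ (θ i)) : ι → Ordinal.{v}))
    ((continuous_single i).comp (continuous_id.min continuous_const)) _

theorem spike_mem_near {c : Ordinal.{v}} {i : ι} {ξ η : Ordinal.{v}} (hη : η ≤ θ i)
    (hξη : ξ ≤ η) (h : η < ξ + c) : (spike e i ξ, spike e i η) ∈ near e c := by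
  have hc : 0 < c := pos_iff_ne_zero.2 (by rintro rfl; simp [hξη.not_gt] at h)
  intro j
  simp only [apply_spike e hη, apply_spike e (hξη.trans hη)]
  rcases eq_or_ne j i with rfl | hj
  · simp only [Pi.single_eq_same]
    exact ⟨hξη.trans_lt (lt_add_of_pos_right _ hc), h⟩
  · simp [hj, hc]

theorem spike_notMem_near {i : ι} {c : Ordinal.{v}} (hc : c ≤ θ i) :
    (spike e i 0, spike e i c) ∉ near e c := by
  intro h
  have := (h i).2
  simp [apply_spike e hc, apply_spike e (zero_le (a := θ i))] at this

theorem spike_notMem_within {i : ι} {c d : Ordinal.{v}} (hcd : c < d) (hd : d ≤ θ i) :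
    (spike e i 0, spike e i d) ∉ within e c := by
  intro h
  have := (h i).2
  simp [apply_spike e hd, apply_spike e (zero_le (a := θ i)), hcd.not_ge] at this

/-- An equivalence relation contains `near e c` as soon as it does so on each of the intervals: two
points on different intervals that are near one another are both near the wedge point. -/
theorem near_subset [Nonempty ι] {c : Ordinal.{v}} {S : Set (Y × Y)}
    (hS : Equivalence fun y z => (y, z) ∈ S)
    (h : ∀ (i : ι) (ξ η : Ordinal.{v}), η ≤ θ i → ξ ≤ η → η < ξ + c →
      (spike e i ξ, spike e i η) ∈ S) : near e c ⊆ S := by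
  rintro ⟨y, z⟩ hyz
  obtain ⟨i, ξ, hξ, rfl⟩ := exists_eq_spike e y
  obtain ⟨j, η, hη, rfl⟩ := exists_eq_spike e z
  have h1 := hyz i
  have h2 := hyz j
  simp only [apply_spike e hξ, apply_spike e hη, Pi.single_eq_same] at h1 h2
  rcases eq_or_ne i j with rfl | hij
  · simp only [Pi.single_eq_same] at h1
    rcases le_total ξ η with hle | hle
    · exact h i ξ η hη hle h1.2
    · exact hS.symm (h i η ξ hξ hle h1.1)
  · simp only [Pi.single_eq_of_ne hij, Pi.single_eq_of_ne hij.symm] at h1 h2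
    have hy := h i 0 ξ hξ zero_le h1.1
    rw [spike_zero e i j] at hy
    exact hS.trans (hS.symm hy) (h j 0 η hη zero_le h2.2)

/-- From steps of length less than `c` and steps of length exactly `c` one obtains all the finite
multiples of `c`. -/
theorem near_mul_omega0_subset [Nonempty ι] {c : Ordinal.{v}} (hc : 0 < c) {S : Set (Y × Y)}
    (hS : Equivalence fun y z => (y, z) ∈ S) (hnear : near e c ⊆ S)
    (hstep : ∀ (i : ι) (ξ : Ordinal.{v}), ξ + c ≤ θ i → (spike e i ξ, spike e i (ξ + c)) ∈ S) :
    near e (c * ω) ⊆ S := by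
  refine near_subset e hS fun i ξ η hη hξη h => ?_
  have hsteps : ∀ n : ℕ, ξ + c * n ≤ θ i → (spike e i ξ, spike e i (ξ + c * n)) ∈ S := by
    intro n hn
    induction n with
    | zero => simp [hS.refl _]
    | succ n ih =>
      rw [Nat.cast_succ, mul_add, mul_one, ← add_assoc] at hn ⊢
      exact hS.trans (ih (le_self_add.trans hn)) (hstep i _ hn)
  rw [lt_add_iff_of_isSuccLimit (isSuccLimit_mul_right hc isSuccLimit_omega0)] at h
  obtain ⟨d, hd, h⟩ := h
  obtain ⟨m, hm, hdm⟩ := (lt_mul_iff_of_isSuccLimit isSuccLimit_omega0).1 hd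
  obtain ⟨n, rfl⟩ := lt_omega0.1 hm
  replace h : η < ξ + c * n := h.trans (by gcongr)
  clear hd hdm hm
  induction n with
  | zero => simp [hξη.not_gt] at h
  | succ n ih =>
    rcases lt_or_ge η (ξ + c * n) with hlt | hge
    · exact ih hlt
    · refine hS.trans (hsteps n (hge.trans hη)) (hnear (spike_mem_near e hη hge ?_))
      rwa [Nat.cast_succ, mul_add, mul_one, ← add_assoc] at h

theorem equivClosure_within_one [Nonempty ι] :
    equivClosure (within e 1) = near e (ω ^ (1 : Ordinal.{v})) := by
  refine (equivClosure_subset (equivalence_near e 1)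
    (within_subset_near e (by simp))).antisymm ?_
  rw [opow_one, ← one_mul ω]
  refine near_mul_omega0_subset e one_pos (equivalence_equivClosure _)
    ((near_subset_within e 1).trans (subset_equivClosure _)) fun i ξ h => subset_equivClosure _ ?_
  intro j
  simp only [apply_spike e h, apply_spike e (le_self_add.trans h)]
  rcases eq_or_ne j i with rfl | hj
  · simp only [Pi.single_eq_same, le_refl, and_true]
    exact le_self_add.trans le_self_add
  · simp [hj]

theorem equivClosure_closure_near [Nonempty ι] {γ : Ordinal.{v}} (hγ : 1 ≤ γ) :
    equivClosure (closure (near e (ω ^ γ))) = near e (ω ^ (γ + 1)) := by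
  have hpos : 0 < ω ^ γ := opow_pos _ omega0_pos
  refine (equivClosure_subset (equivalence_near e _) ((closure_minimal (near_subset_within e _)
    (isClosed_within e _)).trans (within_subset_near e ?_))).antisymm ?_
  · exact (opow_lt_opow_iff_right one_lt_omega0).2 (lt_add_one γ)
  rw [opow_add, opow_one]
  refine near_mul_omega0_subset e hpos (equivalence_equivClosure _)
    (subset_closure.trans (subset_equivClosure _)) fun i ξ h => subset_equivClosure _ ?_
  -- for `γ ≥ 1` the ordinal `ξ + ω ^ γ` is the limit of the smaller ones
  have hlim : Order.IsSuccLimit (ξ + ω ^ γ) := isSuccLimit_add ξ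
    (isSuccLimit_opow_left isSuccLimit_omega0 (pos_iff_ne_zero.1 (Order.one_le_iff_pos.1 hγ)))
  have hlt : ξ < ξ + ω ^ γ := lt_add_of_pos_right _ hpos
  have hcl : ξ + ω ^ γ ∈ closure (Iio (ξ + ω ^ γ) ∩ Ici ξ) :=
    (hlim.isLUB_Iio.inter_Ici_of_mem hlt).mem_closure ⟨ξ, hlt, mem_Ici.2 le_rfl⟩
  exact map_mem_closure (f := fun η => (spike e i ξ, spike e i η))
    (continuous_const.prodMk (continuous_spike e i)) hcl fun η hη =>
      spike_mem_near e (hη.1.le.trans h) hη.2 hη.1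

theorem near_limit [Nonempty ι] {γ : Ordinal.{v}} (hγ : Order.IsSuccLimit γ) :
    near e (ω ^ γ) = ⋃ (δ : Ordinal) (_ : 1 ≤ δ) (_ : δ < γ), near e (ω ^ δ) := by
  refine Subset.antisymm ?_ (iUnion_subset fun δ => iUnion₂_subset fun _ hδ =>
    near_mono e ((opow_le_opow_iff_right one_lt_omega0).2 hδ.le))
  have hmono : ∀ {δ δ' : Ordinal.{v}}, δ ≤ δ' → near e (ω ^ δ) ⊆ near e (ω ^ δ') := fun h =>
    near_mono e ((opow_le_opow_iff_right one_lt_omega0).2 h)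
  have h1 : (1 : Ordinal) < γ := by simpa using hγ.add_one_lt hγ.bot_lt
  refine near_subset e ⟨fun y => ?_, fun h => ?_, fun h h' => ?_⟩ fun i ξ η hη hξη h => ?_
  · exact mem_iUnion.2 ⟨1, mem_iUnion₂.2 ⟨le_rfl, h1, (equivalence_near e 1).refl y⟩⟩
  · simp only [mem_iUnion] at h ⊢
    obtain ⟨δ, hδ, hδγ, h⟩ := h
    exact ⟨δ, hδ, hδγ, (equivalence_near e δ).symm h⟩
  · simp only [mem_iUnion] at h h' ⊢
    obtain ⟨δ, hδ, hδγ, h⟩ := h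
    obtain ⟨δ', hδ', hδγ', h'⟩ := h'
    exact ⟨max δ δ', hδ.trans (le_max_left _ _), max_lt hδγ hδγ',
      (equivalence_near e _).trans (hmono (le_max_left _ _) h) (hmono (le_max_right _ _) h')⟩
  · have hlim := isSuccLimit_opow one_lt_omega0 hγ
    obtain ⟨d, hd, h⟩ := (lt_add_iff_of_isSuccLimit hlim).1 h
    obtain ⟨δ, hδ, hdδ⟩ := (lt_opow_of_isSuccLimit omega0_ne_zero hγ).1 hd
    refine mem_iUnion.2 ⟨max 1 δ, mem_iUnion₂.2 ⟨le_max_left _ _, max_lt h1 hδ, ?_⟩⟩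
    exact hmono (le_max_right _ _) (spike_mem_near e hη hξη (h.trans (by gcongr)))

end Relations

/-! ### The hierarchy of the clique shift over a wedge -/

section WedgeShift

variable {G : Type*} [Group G] {Y : Type*} [TopologicalSpace Y]

/-- Over the interval `[0, ω ^ γ]` with `γ ≥ 1`, the only configuration taking the value `ω ^ γ` is
the constant one, because `ω ^ γ` is not a successor. Hence the configurations with values below
`ω ^ γ` are dense. -/
theorem mem_closure_coord_lt {γ : Ordinal.{v}} (hγ : 1 ≤ γ)
    (e : Y ≃ₜ wedge fun _ : Unit => ω ^ γ) (u : CliqueShift G (within e 1)) :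
    u ∈ closure {w : CliqueShift G (within e 1) | (e (w 1)).1 () < ω ^ γ} := by
  have hlim : Order.IsSuccLimit (ω ^ γ) :=
    isSuccLimit_opow_left isSuccLimit_omega0 (pos_iff_ne_zero.1 (Order.one_le_iff_pos.1 hγ))
  rcases ((e (u 1)).2.1 ()).lt_or_eq with hlt | heq
  · exact subset_closure hlt
  have hu : u = CliqueShift.const (within_refl e 1) (spike e () (ω ^ γ)) := by
    refine Subtype.ext (funext fun g => e.injective (Subtype.ext (funext fun i => ?_)))
    rw [CliqueShift.const_apply, apply_spike e le_rfl, Pi.single_eq_same]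
    refine ((e (u g)).2.1 i).antisymm (le_of_not_gt fun hlt => ?_)
    exact ((hlim.add_one_lt hlt).trans_le heq.ge).not_ge (u.rel 1 g ()).1
  rw [hu]
  have hcl : ω ^ γ ∈ closure (Iio (ω ^ γ)) := hlim.isLUB_Iio.mem_closure ⟨0, hlim.bot_lt⟩
  refine map_mem_closure (f := fun ξ => (CliqueShift.const (within_refl e 1) (spike e () ξ) :
    CliqueShift G (within e 1)))
    ((CliqueShift.continuous_const _).comp (continuous_spike e ())) hcl fun ξ hξ => ?_
  change (e (spike e () ξ)).1 () < ω ^ γ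
  rw [apply_spike e (le_of_lt hξ), Pi.single_eq_same]
  exact hξ

variable [Infinite G] {F : ℕ → Finset G} {ι : Type*} {θ : ι → Ordinal.{v}} (e : Y ≃ₜ wedge θ)

theorem entropyHierarchy_wedge_one (hF : IsFolnerSeq F) :
    entropyHierarchy (CliqueShift G (within e 1)) F (1 : Ordinal.{v}) =
      CliqueShift.jointCliques G (within e 1) := by
  have := t2Space_of_homeomorph_wedge e
  have := compactSpace_of_homeomorph_wedge e
  exact CliqueShift.entropyHierarchy_one hF (isClosed_within e 1) (within_symm e 1)

variable [DecidableEq ι] [Nonempty ι]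

theorem entropyHierarchy_wedge_two_mul (hF : IsFolnerSeq F) {γ : Ordinal.{v}} (hγ : 1 ≤ γ) :
    entropyHierarchy (CliqueShift G (within e 1)) F (2 * γ) =
      CliqueShift.pullback G (within e 1) (near e (ω ^ γ)) := by
  have := t2Space_of_homeomorph_wedge e
  have := compactSpace_of_homeomorph_wedge e
  exact CliqueShift.entropyHierarchy_two_mul hF (isClosed_within e 1) (within_refl e 1)
    (within_symm e 1) (Q := fun γ => near e (ω ^ γ)) (equivalence_near e)
    (equivClosure_within_one e) (fun _ => equivClosure_closure_near e) (fun _ => near_limit e) hγ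

theorem entropyHierarchy_wedge_two_mul_add_one (hF : IsFolnerSeq F) {γ : Ordinal.{v}}
    (hγ : 1 ≤ γ) :
    entropyHierarchy (CliqueShift G (within e 1)) F (2 * γ + 1) =
      closure (CliqueShift.pullback G (within e 1) (near e (ω ^ γ))) := by
  have := t2Space_of_homeomorph_wedge e
  have := compactSpace_of_homeomorph_wedge e
  exact CliqueShift.entropyHierarchy_two_mul_add_one hF (isClosed_within e 1) (within_refl e 1)
    (within_symm e 1) (Q := fun γ => near e (ω ^ γ)) (equivalence_near e)
    (equivClosure_within_one e) (fun _ => equivClosure_closure_near e) (fun _ => near_limit e) hγ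

/-- An upper bound that also covers the first stage, `γ = 0`. -/
theorem entropyHierarchy_wedge_subset (hF : IsFolnerSeq F) (γ : Ordinal.{v}) :
    entropyHierarchy (CliqueShift G (within e 1)) F (2 * γ + 1) ⊆
      CliqueShift.pullback G (within e 1) (within e (ω ^ γ)) := by
  rcases eq_or_ne γ 0 with rfl | hγ
  · rw [mul_zero, zero_add, entropyHierarchy_wedge_one e hF, opow_zero]
    intro p (hp : ∀ g h, (p.1 g, p.2 h) ∈ within e 1)
    exact hp 1 1
  · rw [entropyHierarchy_wedge_two_mul_add_one e hF (Order.one_le_iff_pos.2 (pos_iff_ne_zero.2 hγ))]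
    exact (CliqueShift.closure_pullback_subset _).trans (CliqueShift.pullback_mono
      (closure_minimal (near_subset_within e _) (isClosed_within e _)))

/-- Class `2 * γ + 1` is attained over `[0, ω ^ γ]`. For `γ = 0` this is the full shift on two
symbols. For `γ ≥ 1` the classes of the alphabet at stage `2 * γ` are `[0, ω ^ γ)` and the top
point, so the next closure is everything. -/
theorem inCPEClass_two_mul_add_one (hF : IsFolnerSeq F) (γ : Ordinal.{v})
    (e : Y ≃ₜ wedge fun _ : Unit => ω ^ γ) :
    InCPEClass (CliqueShift G (within e 1)) F (2 * γ + 1) := by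
  rcases eq_or_ne γ 0 with rfl | hγ
  · rw [mul_zero, zero_add]
    refine ⟨?_, fun β h h' => absurd h h'.not_ge⟩
    rw [entropyHierarchy_wedge_one e hF]
    refine eq_univ_of_forall fun p g h i => ?_
    have h1 := (e (p.1 g)).2.1 i
    have h2 := (e (p.2 h)).2.1 i
    exact ⟨(h1.trans_eq (opow_zero _)).trans le_add_self,
      (h2.trans_eq (opow_zero _)).trans le_add_self⟩
  · have hγ1 : 1 ≤ γ := Order.one_le_iff_pos.2 (pos_iff_ne_zero.2 hγ)
    refine ⟨?_, fun β _ hβ hu => ?_⟩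
    · rw [entropyHierarchy_wedge_two_mul_add_one e hF hγ1]
      refine eq_univ_of_forall fun p => ?_
      have hp := mk_mem_prod (mem_closure_coord_lt hγ1 e p.1) (mem_closure_coord_lt hγ1 e p.2)
      rw [← closure_prod_eq] at hp
      refine closure_mono ?_ hp
      rintro ⟨u, v⟩ ⟨hu, hv⟩ _
      exact ⟨lt_of_lt_of_le hu le_add_self, lt_of_lt_of_le hv le_add_self⟩
    · have := entropyHierarchy_mono F (X := CliqueShift G (within e 1)) (Order.lt_add_one_iff.1 hβ)
      rw [hu, entropyHierarchy_wedge_two_mul e hF hγ1] at this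
      exact CliqueShift.pullback_ne_univ (within_refl e 1)
        (spike_notMem_near e (i := ()) le_rfl) (univ_subset_iff.1 this)

/-- Class `2 * γ + 2` is attained over `[0, ω ^ γ + 1]`, where `0` and the top point are farther
than `ω ^ γ` apart, but less than `ω ^ (γ + 1)`. -/
theorem inCPEClass_two_mul_add_two (hF : IsFolnerSeq F) (γ : Ordinal.{v})
    (e : Y ≃ₜ wedge fun _ : Unit => ω ^ γ + 1) :
    InCPEClass (CliqueShift G (within e 1)) F (2 * (γ + 1)) := by
  refine ⟨?_, fun β _ hβ hu => ?_⟩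
  · rw [entropyHierarchy_wedge_two_mul e hF (by simp)]
    have hlt : ω ^ γ + 1 < ω ^ (γ + 1) :=
      isPrincipal_add_omega0_opow (γ + 1)
        ((opow_lt_opow_iff_right one_lt_omega0).2 (lt_add_one γ))
        (one_lt_omega0.trans_le (by
          simpa using opow_le_opow_right omega0_pos (show (1 : Ordinal) ≤ γ + 1 by simp)))
    exact eq_univ_of_forall fun p i =>
      ⟨(((e _).2.1 i).trans_lt hlt).trans_le le_add_self,
        (((e _).2.1 i).trans_lt hlt).trans_le le_add_self⟩
  · rw [mul_add, mul_one, ← one_add_one_eq_two (R := Ordinal), ← add_assoc,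
      one_add_one_eq_two] at hβ
    have := (entropyHierarchy_mono F (X := CliqueShift G (within e 1))
      (Order.lt_add_one_iff.1 hβ)).trans (entropyHierarchy_wedge_subset e hF γ)
    rw [hu] at this
    exact CliqueShift.pullback_ne_univ (within_refl e 1)
        (spike_notMem_within e (i := ()) (lt_add_one _) le_rfl)
      (univ_subset_iff.1 this)

/-- Class `2 * γ`, for a limit ordinal `γ`, is attained over the wedge of all the intervals
`[0, ω ^ i]`, `i < γ`. No single interval would do, but any two points of the wedge lie in finitely
many intervals, so that they are related before stage `2 * γ`. -/
theorem inCPEClass_two_mul_limit (hF : IsFolnerSeq F) {γ : Ordinal.{v}} (hγ : Order.IsSuccLimit γ)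
    (e : Y ≃ₜ wedge fun i : Iio γ => ω ^ (i : Ordinal.{v})) :
    InCPEClass (CliqueShift G (within e 1)) F (2 * γ) := by
  classical
  have h1 : (1 : Ordinal) < γ := by simpa using hγ.add_one_lt hγ.bot_lt
  have : Nonempty (Iio γ) := ⟨⟨1, h1⟩⟩
  refine ⟨?_, fun β _ hβ hu => ?_⟩
  · rw [entropyHierarchy_wedge_two_mul e hF h1.le]
    have hlt : ∀ i : Iio γ, ω ^ (i : Ordinal) < ω ^ γ := fun i =>
      (opow_lt_opow_iff_right one_lt_omega0).2 i.2
    exact eq_univ_of_forall fun p i =>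
      ⟨(((e _).2.1 i).trans_lt (hlt i)).trans_le le_add_self,
        (((e _).2.1 i).trans_lt (hlt i)).trans_le le_add_self⟩
  · obtain ⟨δ, hδ, hβδ⟩ := (lt_mul_iff_of_isSuccLimit hγ).1 hβ
    have hδ1 : δ + 1 < γ := hγ.add_one_lt hδ
    have := entropyHierarchy_mono F (X := CliqueShift G (within e 1))
      (hβδ.le.trans (mul_le_mul_right (lt_add_one δ).le 2))
    rw [hu, entropyHierarchy_wedge_two_mul e hF (by simp)] at this
    exact CliqueShift.pullback_ne_univ (within_refl e 1)
        (spike_notMem_near e (i := (⟨δ + 1, hδ1⟩ : Iio γ)) le_rfl)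
      (univ_subset_iff.1 this)

end WedgeShift

/-- A clique shift over a countable wedge of countable ordinal intervals is a compact metrizable
system. The wedge is countable, so the alphabet can be replaced by a homeomorphic copy in the
lowest universe. -/
theorem exists_system_of_wedge {G : Type u} [Group G] [Countable G] {α : Ordinal.{v}} {ι : Type*}
    [Countable ι] [Nonempty ι] (θ : ι → Ordinal.{v}) (hθ : ∀ i, (θ i).card ≤ ℵ₀)
    (h : ∀ (Y : Type) (_ : TopologicalSpace Y) (e : Y ≃ₜ wedge θ) (F : ℕ → Finset G),
      IsFolnerSeq F → InCPEClass (CliqueShift G (within e 1)) F α) :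
    ∃ (X : Type u) (_ : MetricSpace X) (_ : CompactSpace X) (_ : Nonempty X)
      (_ : MulAction G X) (_ : ContinuousConstSMul G X),
      ∀ F : ℕ → Finset G, IsFolnerSeq F → InCPEClass X F α := by
  classical
  have : Countable (wedge θ) := countable_wedge hθ
  have : SecondCountableTopology (wedge θ) := secondCountableTopology_wedge hθ
  let e : Shrink.{0} (wedge θ) ≃ₜ wedge θ := (Shrink.homeomorph _).symm
  have : SecondCountableTopology (Shrink.{0} (wedge θ)) := e.isInducing.secondCountableTopology
  have := t2Space_of_homeomorph_wedge e
  have := compactSpace_of_homeomorph_wedge e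
  have : CompactSpace (CliqueShift G (within e 1)) :=
    CliqueShift.compactSpace (isClosed_within e 1)
  have : Nonempty (CliqueShift G (within e 1)) :=
    ⟨CliqueShift.const (within_refl e 1) (spike e (Classical.arbitrary ι) 0)⟩
  exact ⟨CliqueShift G (within e 1), TopologicalSpace.metrizableSpaceMetric _, inferInstance,
    inferInstance, inferInstance, inferInstance, h _ _ e⟩

theorem card_omega0_opow_le {γ : Ordinal.{v}} (h : γ.card ≤ ℵ₀) : (ω ^ γ).card ≤ ℵ₀ :=
  (card_opow_le ω γ).trans (by simp [h])

end CPE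

open CPE in
theorem theorem3p2 {G : Type u} [Group G] [Countable G] [Infinite G] (hG : CPE.IsAmenable G)
    (α : Ordinal.{v}) (hα : 1 ≤ α) (hαc : α.card ≤ ℵ₀) :
    ∃ (X : Type u) (_ : MetricSpace X) (_ : CompactSpace X) (_ : Nonempty X)
      (_ : MulAction G X) (_ : ContinuousConstSMul G X),
      ∀ F : ℕ → Finset G, CPE.IsFolnerSeq F → CPE.InCPEClass X F α := by
  -- write `α = 2 * γ` or `α = 2 * γ + 1`
  obtain ⟨γ, hγ⟩ : ∃ γ, α = 2 * γ ∨ α = 2 * γ + 1 := by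
    refine ⟨α / 2, ?_⟩
    have h1 := Ordinal.div_add_mod α 2
    have h2 : α % 2 < 2 := Ordinal.mod_lt α two_ne_zero
    rw [← one_add_one_eq_two, Order.lt_add_one_iff, one_add_one_eq_two,
      Order.le_one_iff] at h2
    rcases h2 with h | h <;> rw [h] at h1
    · exact Or.inl (by simpa using h1.symm)
    · exact Or.inr h1.symm
  have hle : γ ≤ α := (Ordinal.le_mul_right γ two_pos).trans (by
    rcases hγ with rfl | rfl
    · exact le_rfl
    · exact le_self_add)
  have hγc : γ.card ≤ ℵ₀ := (Ordinal.card_le_card hle).trans hαc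
  rcases hγ with rfl | rfl
  · rcases Ordinal.zero_or_succ_or_isSuccLimit γ with rfl | ⟨δ, rfl⟩ | hlim
    · simp at hα
    · have hδ : δ.card ≤ ℵ₀ := (Ordinal.card_le_card (Order.le_succ δ)).trans hγc
      refine exists_system_of_wedge (fun _ : Unit => Ordinal.omega0 ^ δ + 1) (fun _ => ?_)
        fun Y _ e F hF => inCPEClass_two_mul_add_two hF δ e
      rw [Ordinal.card_add, Ordinal.card_one]
      exact Cardinal.add_le_aleph0.2 ⟨card_omega0_opow_le hδ, Cardinal.one_le_aleph0⟩
    · have : Countable (Iio γ) := (countable_Iic hγc).mono Iio_subset_Iic_self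
      have : Nonempty (Iio γ) := ⟨⟨0, hlim.bot_lt⟩⟩
      exact exists_system_of_wedge (fun i : Iio γ => Ordinal.omega0 ^ (i : Ordinal))
        (fun i => card_omega0_opow_le ((Ordinal.card_le_card (le_of_lt i.2)).trans hγc))
        fun Y _ e F hF => inCPEClass_two_mul_limit hF hlim e
  · exact exists_system_of_wedge (fun _ : Unit => Ordinal.omega0 ^ γ)
      (fun _ => card_omega0_opow_le hγc) fun Y _ e F hF => inCPEClass_two_mul_add_one hF γ e
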